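/- Let $S=\mathbb{C}[x,y,z]$. For $f\in S$ homogeneous of degree $d\ge 1$ and squarefree, let $J_f=(f_x,f_y,f_z)$ be its Jacobian ideal and $M(f)=S/J_f$ its Milnor algebra. The reduced curve $C:f=0$ in $\mathbb{P}^2_{\mathbb{C}}$ is called an $m$-syzygy curve ($m\ge 2$) with exponents $(d_1,\dots,d_m)$ if $M(f)$ has a minimal graded free resolution $$0\to\bigoplus_{i=1}^{m-2}S(-e_i)\to\bigoplus_{i=1}^{m}S(1-d-d_i)\to S^3(1-d)\xrightarrow{(f_x,f_y,f_z)}S\to M(f)\to 0$$ with $e_1\le\dots\le e_{m-2}$ and $1\le d_1\le\dots\le d_m$. It is called plus–one generated with exponents $(d_1,d_2,d_3)$ if it is a $3$-syzygy curve with these exponents and $d_1+d_2=d$, and nearly free if moreover $d_3=d_2$. A line arrangement is identified with the reduced curve that is the union of its lines. **Proposition 5.4.** Let $\mathcal{H}\subset\mathbb{P}^2_{\mathbb{C}}$ be the dual Hesse arrangement, i.e. the arrangement of the $9$ lines that is given, in suitable projective coordinates, by $(x^3-y^3)(y^3-z^3)(z^3-x^3)=0$, and let $\ell\in\mathcal{H}$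 be any line. Then $\mathcal{H}':=\mathcal{H}\setminus\{\ell\}$ is plus–one generated with exponents $(4,4,4)$; hence $\mathcal{H}'$ is nearly free. -/

import Mathlib

open MvPolynomial

noncomputable section

namespace PlaneCurve

/-- The polynomial ring `S = ℂ[x, y, z]`, with `x = X 0`, `y = X 1`, `z = X 2`. -/
abbrev S : Type := MvPolynomial (Fin 3) ℂ

/-- The equation `f` defines a reduced curve of degree `d` in the complex projective plane. -/
structure IsReducedCurve (f : S) (d : ℕ) : Prop where
  one_le : 1 ≤ d
  isHomogeneous : f.IsHomogeneous d
  squarefree : Squarefree f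

/-- The Jacobian ideal `J_f = (f_x, f_y, f_z)`. -/
def jacobianIdeal (f : S) : Ideal S := Ideal.span (Set.range fun i : Fin 3 => pderiv i f)

/-- The Milnor algebra `M(f) = S / J_f`. -/
abbrev MilnorAlgebra (f : S) : Type := S ⧸ jacobianIdeal f

/-- The map `S³ → S`, `(a, b, c) ↦ a f_x + b f_y + c f_z`. For `f` homogeneous of degree `d` it is
a homomorphism of degree zero `S³(1 - d) → S`. -/
def gradientMap (f : S) : (Fin 3 → S) →ₗ[S] S :=
  Fintype.linearCombination S (fun i : Fin 3 => pderiv i f)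

/-- The matrix `A` is the matrix of a homomorphism of degree zero of graded free modules
`⨁ j, S(-b j) → ⨁ i, S(-a i)` that is minimal, i.e. maps into `(x, y, z) • ⨁ i, S(-a i)`:
the entry `A i j` is homogeneous of degree `b j - a i` (zero if this is negative),
and no entry has a nonzero constant term. -/
def IsMinimalGraded {m n : ℕ} (a : Fin m → ℕ) (b : Fin n → ℕ)
    (A : Matrix (Fin m) (Fin n) S) : Prop :=
  ∀ i j, (A i j = 0 ∨ (a i ≤ b j ∧ (A i j).IsHomogeneous (b j - a i))) ∧
    constantCoeff (A i j) = 0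

/-- `f`, of degree `d`, defines an `m`-syzygy curve with exponents `δ 0 ≤ δ 1 ≤ ⋯`: the curve is
reduced and the Milnor algebra has a minimal graded free resolution
`0 → ⨁_{i < m - 2} S(-e i) → ⨁_{j < m} S(1 - d - δ j) → S³(1 - d) → S → M(f) → 0`
with `e` and `δ` nondecreasing and `1 ≤ δ j`. (The entries of `S³(1 - d) → S` have no constant
term either: otherwise `d = 1`, and the syzygies would have a generator of degree `0`.) -/
def IsSyzygyCurve (f : S) (d m : ℕ) (δ : Fin m → ℕ) : Prop :=
  IsReducedCurve f d ∧ 2 ≤ m ∧ Monotone δ ∧ (∀ j, 1 ≤ δ j) ∧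
    ∃ (e : Fin (m - 2) → ℕ) (A : Matrix (Fin 3) (Fin m) S) (B : Matrix (Fin m) (Fin (m - 2)) S),
      Monotone e ∧
      IsMinimalGraded (fun _ => d - 1) (fun j => d - 1 + δ j) A ∧
      IsMinimalGraded (fun j => d - 1 + δ j) e B ∧
      Function.Injective B.mulVecLin ∧
      Function.Exact B.mulVecLin A.mulVecLin ∧
      Function.Exact A.mulVecLin (gradientMap f) ∧
      Function.Exact (gradientMap f) (jacobianIdeal f).mkQ ∧
      Function.Surjective (jacobianIdeal f).mkQ

/-- The reduced curve `f = 0` is plus-one generated with exponents `(d₁, d₂, d₃)`: it is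
`3`-syzygy with these exponents and `d₁ + d₂` is its degree. -/
def IsPlusOneGenerated (f : S) (d₁ d₂ d₃ : ℕ) : Prop :=
  ∃ d : ℕ, IsSyzygyCurve f d 3 ![d₁, d₂, d₃] ∧ d₁ + d₂ = d

/-- The curve `f = 0` is nearly free: plus-one generated with `d₃ = d₂`. -/
def IsNearlyFree (f : S) : Prop :=
  ∃ d₁ d₂ d₃ : ℕ, IsPlusOneGenerated f d₁ d₂ d₃ ∧ d₃ = d₂

/-- Lines in the complex projective plane `ℙ(ℂ³)`: nonzero linear forms `φ` on `ℂ³` up to scalars,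
the class of `φ` being the line `φ = 0`. -/
abbrev Line : Type := Projectivization ℂ (Module.Dual ℂ (Fin 3 → ℂ))

/-- A linear form on `ℂ³` as a polynomial in the coordinates `x, y, z`. -/
def formPolynomial (φ : Module.Dual ℂ (Fin 3 → ℂ)) : S :=
  ∑ i : Fin 3, C (φ (Pi.single i 1)) * X i

/-- `f = 0` is an equation of the line arrangement `L`: up to a nonzero constant, `f` is the product
of linear forms that define the lines of `L`, one for each line. -/
def IsEquation (L : Finset Line) (f : S) : Prop :=
  ∃ c : ℂ, c ≠ 0 ∧ f = C c * ∏ ℓ ∈ L, formPolynomial ℓ.rep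

/-- With indices modulo `3`, the linear form `x_i - ζ x_{i+1}` on `ℂ³`. -/
def hesseForm (i : Fin 3) (ζ : ℂ) : Module.Dual ℂ (Fin 3 → ℂ) :=
  LinearMap.proj i - ζ • LinearMap.proj (i + 1)

theorem hesseForm_ne_zero (i : Fin 3) (ζ : ℂ) : hesseForm i ζ ≠ 0 := by
  intro h
  have h1 := LinearMap.congr_fun h (Pi.single i 1)
  fin_cases i <;> simp [hesseForm] at h1

/-- The nine lines `x = ζ y`, `y = ζ z`, `z = ζ x` with `ζ³ = 1`, whose union is
`(x³ - y³)(y³ - z³)(z³ - x³) = 0`. -/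
def standardDualHesse : Set Line :=
  {ℓ | ∃ (i : Fin 3) (ζ : ℂ), ζ ^ 3 = 1 ∧
    ℓ = Projectivization.mk ℂ (hesseForm i ζ) (hesseForm_ne_zero i ζ)}

/-- The dual Hesse arrangement, in arbitrary projective coordinates: `H` is the image of the nine
standard lines under a projective transformation of the plane, induced by `e⁻¹ : ℂ³ → ℂ³`, which
takes the line `φ = 0` to the line `φ ∘ e = 0`. -/
def IsDualHesse (H : Finset Line) : Prop :=
  ∃ e : (Fin 3 → ℂ) ≃ₗ[ℂ] (Fin 3 → ℂ),
    (H : Set Line) =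
      Projectivization.map e.dualMap.toLinearMap e.dualMap.injective '' standardDualHesse

end PlaneCurve

end

noncomputable section

namespace PlaneCurve

/-! The symmetries of the dual Hesse arrangement reduce everything to one deletion, that of `x = y`,
with equation `f` of degree 8 (`exists_linearSubst_deletedHesse`, `IsSyzygyCurve.linearSubst`).

The derivations E = (x, y, z), θ₁ = (x⁴, y⁴, z⁴) and θ₂ = (y²z², x²z², x²y²) have determinant (x -
y)f; this is Saito's criterion for the full arrangement. Each maps `f` to a multiple of `f`: E f =
8f, θᵢ f = qᵢ f. Hence σᵢ = 8θᵢ - qᵢE are syzygies. For any syzygy v, Cramer's rule, with numerators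
divisible by `f` because `f` is squarefree, gives 8(x - y)v = bσ₁ + cσ₂
(`exists_combination_of_gradientMap_eq_zero`).

Along x = y this forces (b, c) to be a multiple of (x, z). Since xσ₁ + zσ₂ is itself divisible by x
- y, one further syzygy σ₃, with xσ₁ + zσ₂ + (x - y)σ₃ = 0, completes a generating set, and this
relation generates all relations. The three syzygies have degree 4 and the relation is linear, so
the resolution is minimal with exponents (4, 4, 4). -/

/-! ### Squarefree polynomials and their gradients -/

theorem dvd_mul_det_of_dvd_mulVec {R n : Type*} [CommRing R] [Fintype n] [DecidableEq n]
    (M : Matrix n n R) (G : n → R) (f : R) (h : ∀ i, f ∣ (M.mulVec G) i) (i : n) :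
    f ∣ M.det * G i := by
  have h1 : M.det * G i = (M.adjugate.mulVec (M.mulVec G)) i := by
    rw [Matrix.mulVec_mulVec, Matrix.adjugate_mul, Matrix.smul_mulVec, Matrix.one_mulVec]
    rfl
  rw [h1]
  exact Finset.dvd_sum fun j _ => (h j).mul_left _

/-- A nonzero derivative has strictly smaller degree in `X i`, so it cannot be a multiple of `u`. -/
theorem pderiv_eq_zero_of_dvd_pderiv {u : S} {i : Fin 3} (h : u ∣ pderiv i u) :
    pderiv i u = 0 := by
  by_contra hne
  have hu : u ≠ 0 := by rintro rfl; simp at hne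
  obtain ⟨q, hq⟩ := h
  have hq0 : q ≠ 0 := by rintro rfl; simp [hq] at hne
  have h1 : degreeOf i (pderiv i u) = degreeOf i u + degreeOf i q := by
    rw [hq, degreeOf_mul_eq hu hq0]
  obtain ⟨m, hm, hm'⟩ : ∃ m ∈ (pderiv i u).support, degreeOf i (pderiv i u) = m i := by
    rw [degreeOf_eq_sup]
    exact Finset.exists_mem_eq_sup _ (by simpa using hne) _
  rw [mem_support_iff, coeff_pderiv] at hm
  have h2 := monomial_le_degreeOf i (mem_support_iff.2 (left_ne_zero_of_mul hm))
  simp at h2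
  omega

theorem isUnit_of_pderiv_eq_zero {u : S} (hu : u ≠ 0) (h : ∀ i, pderiv i u = 0) : IsUnit u := by
  have h1 : u = C (coeff 0 u) := by
    ext m
    rw [coeff_C]
    split_ifs with hm
    · rw [hm]
    · obtain ⟨i, hi⟩ : ∃ i, m i ≠ 0 := by
        by_contra! hc
        exact hm (Finsupp.ext fun i => (hc i).symm)
      have h2 := congrArg (coeff (m - Finsupp.single i 1)) (h i)
      have h3 : m - Finsupp.single i 1 + Finsupp.single i 1 = m :=
        tsub_add_cancel_of_le (by simpa using Nat.one_le_iff_ne_zero.2 hi)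
      rw [coeff_pderiv, h3, coeff_zero] at h2
      exact (mul_eq_zero.1 h2).resolve_right (Nat.cast_add_one_ne_zero _)
  rw [h1] at hu ⊢
  exact (isUnit_iff_ne_zero.2 (by rintro h; simp [h] at hu)).map C

/-- A squarefree polynomial has no common factor with all its partial derivatives. -/
theorem dvd_of_squarefree_of_dvd_mul_pderiv {f h : S} (hf : Squarefree f)
    (hd : ∀ i, f ∣ h * pderiv i f) : f ∣ h := by
  have hf0 : f ≠ 0 := hf.ne_zero
  obtain ⟨u, k, g, huk, rfl, rfl⟩ := UniqueFactorizationMonoid.exists_reduced_factors f hf0 h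
  have hg : g ≠ 0 := left_ne_zero_of_mul hf0
  have hu : u ≠ 0 := right_ne_zero_of_mul hf0
  have hgu : IsRelPrime g u := (squarefree_mul_iff.1 hf).1
  -- With f = gu and h = gk, the part `u` of `f` missing from `h` is coprime to both `k` and `g`;
  -- cancelling them leaves `u ∣ pderiv i u`.
  have h1 : ∀ i, u ∣ pderiv i u := fun i => by
    have h2 := hd i
    rw [mul_assoc] at h2
    have h3 := huk.dvd_of_dvd_mul_left ((mul_dvd_mul_iff_left hg).1 h2)
    rw [pderiv_mul] at h3
    exact hgu.symm.dvd_of_dvd_mul_left ((dvd_add_right (dvd_mul_left _ _)).1 h3)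
  have h4 : IsUnit u := isUnit_of_pderiv_eq_zero hu fun i => pderiv_eq_zero_of_dvd_pderiv (h1 i)
  exact mul_dvd_mul_left _ h4.dvd

/-! ### The syzygies of the deletion of x = y -/

/-- The equation of the dual Hesse arrangement without the line `x = y`. -/
def deletedHesse : S :=
  (X 0 ^ 2 + X 0 * X 1 + X 1 ^ 2) * (X 1 ^ 3 - X 2 ^ 3) * (X 2 ^ 3 - X 0 ^ 3)

theorem pderiv_deletedHesse (i : Fin 3) : pderiv i deletedHesse =
    (![(2 * X 0 + X 1) * (X 1 ^ 3 - X 2 ^ 3) * (X 2 ^ 3 - X 0 ^ 3)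
        - 3 * X 0 ^ 2 * (X 0 ^ 2 + X 0 * X 1 + X 1 ^ 2) * (X 1 ^ 3 - X 2 ^ 3),
      (X 0 + 2 * X 1) * (X 1 ^ 3 - X 2 ^ 3) * (X 2 ^ 3 - X 0 ^ 3)
        + 3 * X 1 ^ 2 * (X 0 ^ 2 + X 0 * X 1 + X 1 ^ 2) * (X 2 ^ 3 - X 0 ^ 3),
      3 * X 2 ^ 2 * (X 0 ^ 2 + X 0 * X 1 + X 1 ^ 2) *
        ((X 1 ^ 3 - X 2 ^ 3) - (X 2 ^ 3 - X 0 ^ 3))] : Fin 3 → S) i := by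
  fin_cases i <;>
    simp [deletedHesse] <;> ring

/-- The three quotients are θᵢ f / f. As E f = 8f, subtracting qᵢE from 8θᵢ makes it annihilate `f`.
Here θ₃ is chosen so that xθ₁ + zθ₂ + (x - y)θ₃ = x(x³ + z³)E. -/
def firstQuotient : S :=
  5 * X 0 ^ 3 + 5 * X 1 ^ 3 + 6 * X 2 ^ 3 - X 0 ^ 2 * X 1 - X 0 * X 1 ^ 2

def secondQuotient : S := X 2 ^ 2 * (X 0 + X 1)

def thirdQuotient : S :=
  3 * X 0 ^ 3 + 4 * X 0 ^ 2 * X 1 + 5 * X 0 * X 1 ^ 2 + X 2 ^ 3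

/-- The columns are the three generating Jacobian syzygies of `deletedHesse`. -/
def syzygyMatrix : Matrix (Fin 3) (Fin 3) S :=
  !![8 * X 0 ^ 4 - firstQuotient * X 0,
      8 * (X 1 ^ 2 * X 2 ^ 2) - secondQuotient * X 0,
      8 * (X 2 ^ 3 * (X 0 + X 1)) - thirdQuotient * X 0;
    8 * X 1 ^ 4 - firstQuotient * X 1,
      8 * (X 0 ^ 2 * X 2 ^ 2) - secondQuotient * X 1,
      8 * (X 0 * X 1 * (X 0 ^ 2 + X 0 * X 1 + X 1 ^ 2) - X 0 * X 2 ^ 3) - thirdQuotient * X 1;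
    8 * X 2 ^ 4 - firstQuotient * X 2,
      8 * (X 0 ^ 2 * X 1 ^ 2) - secondQuotient * X 2,
      8 * (X 0 ^ 2 * X 2 * (X 0 + X 1)) - thirdQuotient * X 2]

/-- The linear relation between the columns of `syzygyMatrix`. -/
def relationMatrix : Matrix (Fin 3) (Fin 1) S := !![X 0; X 2; X 0 - X 1]

theorem deletedHesse_isHomogeneous : deletedHesse.IsHomogeneous 8 := by
  have hX (i : Fin 3) (n : ℕ) : (X i ^ n : S).IsHomogeneous n := isHomogeneous_X_pow i n
  have h : (X 0 * X 1 : S).IsHomogeneous 2 := (isHomogeneous_X ℂ 0).mul (isHomogeneous_X ℂ 1)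
  exact ((((hX 0 2).add h).add (hX 1 2)).mul ((hX 1 3).sub (hX 2 3))).mul ((hX 2 3).sub (hX 0 3))

theorem prime_formPolynomial {φ : Module.Dual ℂ (Fin 3 → ℂ)} (hφ : φ ≠ 0) :
    Prime (formPolynomial φ) := by
  set c : Fin 3 →₀ ℂ := Finsupp.equivFunOnFinite.symm fun i => φ (Pi.single i 1)
  have h : formPolynomial φ = sumSMulX c := by
    simp [formPolynomial, sumSMulX, Finsupp.linearCombination_apply, Finsupp.sum_fintype, c,
      smul_eq_C_mul]
  obtain ⟨i, hi⟩ : ∃ i, φ (Pi.single i 1) ≠ 0 := by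
    by_contra! hc
    exact hφ (LinearMap.pi_ext' fun i => LinearMap.ext_ring (by simpa using hc i))
  rw [h]
  refine (irreducible_sumSMulX c ⟨i, by simpa [c] using hi⟩ fun r hr => ?_).prime
  exact isUnit_of_dvd_unit (hr i) (isUnit_iff_ne_zero.2 hi)

theorem X_sub_X_prime : Prime (X 0 - X 1 : S) := by
  have h : (X 0 - X 1 : S) = formPolynomial (hesseForm 0 1) := by
    simp [formPolynomial, hesseForm, Fin.sum_univ_three, sub_eq_add_neg]
  rw [h]
  exact prime_formPolynomial (hesseForm_ne_zero 0 1)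

theorem not_X_sub_X_dvd {p : S} (h : eval ![1, 1, 0] p ≠ 0) : ¬ (X 0 - X 1 : S) ∣ p := by
  rintro ⟨q, rfl⟩
  simp at h

theorem X_sub_X_dvd_sub (p : S) :
    (X 0 - X 1 : S) ∣ p - aeval (![X 0, X 0, X 2] : Fin 3 → S) p := by
  have h : (Ideal.Quotient.mkₐ ℂ (Ideal.span {(X 0 - X 1 : S)})).comp
      (aeval (![X 0, X 0, X 2] : Fin 3 → S)) = Ideal.Quotient.mkₐ ℂ _ := by
    refine algHom_ext fun i => ?_
    fin_cases i
    · simp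
    · simp only [AlgHom.comp_apply, Ideal.Quotient.mkₐ_eq_mk, aeval_X]
      exact Ideal.Quotient.eq.2 (Ideal.mem_span_singleton_self _)
    · simp
  rw [← Ideal.mem_span_singleton, ← Ideal.Quotient.eq]
  exact (DFunLike.congr_fun h p).symm

/-- Modulo x - y one works in ℂ[x, z], realised by the substitution y ↦ x. There x and z are
coprime, so bz = cx makes (b, c) a multiple of (x, z). -/
theorem eq_of_X_sub_X_dvd_sub {b c : S} (h : (X 0 - X 1 : S) ∣ b * X 2 - c * X 0) :
    ∃ s₁ s₂ t, b = (X 0 - X 1) * s₁ + X 0 * t ∧ c = (X 0 - X 1) * s₂ + X 2 * t := by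
  set φ : S →ₐ[ℂ] S := aeval (![X 0, X 0, X 2] : Fin 3 → S)
  obtain ⟨q, hq⟩ := h
  have h1 : φ b * X 2 = φ c * X 0 := by
    have := congrArg φ hq
    simp only [map_sub, map_mul, φ, aeval_X] at this
    simpa [sub_eq_zero, φ] using this
  have h2 : (X 0 : S) ∣ φ b := by
    refine (X_prime.dvd_or_dvd (Dvd.intro_left _ h1.symm)).resolve_right fun h => ?_
    simpa using X_dvd_X.1 h
  obtain ⟨t, ht⟩ := h2
  have h3 : φ c = X 2 * t := by
    refine mul_right_cancel₀ (X_ne_zero (0 : Fin 3)) ?_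
    rw [← h1, ht]; ring
  obtain ⟨s₁, h₁⟩ := X_sub_X_dvd_sub b
  obtain ⟨s₂, h₂⟩ := X_sub_X_dvd_sub c
  exact ⟨s₁, s₂, t, by rw [← ht, ← h₁]; ring, by rw [← h3, ← h₂]; ring⟩

/-- Cramer's rule for the Saito matrix of the dual Hesse arrangement. -/
theorem exists_combination_of_gradientMap_eq_zero (hs : Squarefree deletedHesse)
    {v : Fin 3 → S} (hv : gradientMap deletedHesse v = 0) :
    ∃ b c : S, ∀ i, 8 * (X 0 - X 1) * v i = b * syzygyMatrix i 0 + c * syzygyMatrix i 1 := by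
  have hv' : v 0 * pderiv 0 deletedHesse + v 1 * pderiv 1 deletedHesse
      + v 2 * pderiv 2 deletedHesse = 0 := by
    simpa [gradientMap, Fintype.linearCombination_apply, Fin.sum_univ_three] using hv
  have key (u w : Fin 3 → S)
      (hu : deletedHesse ∣ u 0 * pderiv 0 deletedHesse + u 1 * pderiv 1 deletedHesse
        + u 2 * pderiv 2 deletedHesse)
      (hw : deletedHesse ∣ w 0 * pderiv 0 deletedHesse + w 1 * pderiv 1 deletedHesse
        + w 2 * pderiv 2 deletedHesse) :
      deletedHesse ∣ Matrix.det (Matrix.of ![v, u, w]) := by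
    -- The adjugate turns divisibility of all three rows applied to the gradient into `f` dividing
    -- det · fᵢ for every i; squarefreeness removes fᵢ.
    refine dvd_of_squarefree_of_dvd_mul_pderiv hs fun i => ?_
    refine dvd_mul_det_of_dvd_mulVec (Matrix.of ![v, u, w]) (fun i => pderiv i deletedHesse) _
      (fun j => ?_) i
    fin_cases j <;> simp [Matrix.mulVec, dotProduct, Fin.sum_univ_three]
    · exact hv' ▸ dvd_zero _
    · exact hu
    · exact hw
  have hE : deletedHesse ∣ X 0 * pderiv 0 deletedHesse + X 1 * pderiv 1 deletedHesse
      + X 2 * pderiv 2 deletedHesse := by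
    refine ⟨8, ?_⟩
    simp only [pderiv_deletedHesse, Matrix.cons_val]
    simp only [deletedHesse]
    ring
  have h1 : deletedHesse ∣ X 0 ^ 4 * pderiv 0 deletedHesse + X 1 ^ 4 * pderiv 1 deletedHesse
      + X 2 ^ 4 * pderiv 2 deletedHesse := by
    refine ⟨firstQuotient, ?_⟩
    simp only [pderiv_deletedHesse, Matrix.cons_val]
    simp only [deletedHesse, firstQuotient]
    ring
  have h2 : deletedHesse ∣ (X 1 ^ 2 * X 2 ^ 2) * pderiv 0 deletedHesse
      + (X 0 ^ 2 * X 2 ^ 2) * pderiv 1 deletedHesse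
      + (X 0 ^ 2 * X 1 ^ 2) * pderiv 2 deletedHesse := by
    refine ⟨secondQuotient, ?_⟩
    simp only [pderiv_deletedHesse, Matrix.cons_val]
    simp only [deletedHesse, secondQuotient]
    ring
  -- The Cramer numerators of E, θ₁ and θ₂, in cyclic order to keep the signs positive, divided by
  -- `f`.
  obtain ⟨a, ha⟩ := key ![X 0 ^ 4, X 1 ^ 4, X 2 ^ 4]
    ![X 1 ^ 2 * X 2 ^ 2, X 0 ^ 2 * X 2 ^ 2, X 0 ^ 2 * X 1 ^ 2] h1 h2
  obtain ⟨b, hb⟩ := key ![X 1 ^ 2 * X 2 ^ 2, X 0 ^ 2 * X 2 ^ 2, X 0 ^ 2 * X 1 ^ 2]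
    ![X 0, X 1, X 2] h2 hE
  obtain ⟨c, hc⟩ := key ![X 0, X 1, X 2] ![X 0 ^ 4, X 1 ^ 4, X 2 ^ 4] hE h1
  have hne := hs.ne_zero
  simp [Matrix.det_fin_three] at ha hb hc
  have hdist (p q r : S) : deletedHesse * (a * p + b * q + c * r)
      = (deletedHesse * a) * p + (deletedHesse * b) * q + (deletedHesse * c) * r := by ring
  have hcomb : (X 0 - X 1) * v 0 = a * X 0 + b * X 0 ^ 4 + c * (X 1 ^ 2 * X 2 ^ 2) ∧
      (X 0 - X 1) * v 1 = a * X 1 + b * X 1 ^ 4 + c * (X 0 ^ 2 * X 2 ^ 2) ∧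
      (X 0 - X 1) * v 2 = a * X 2 + b * X 2 ^ 4 + c * (X 0 ^ 2 * X 1 ^ 2) := by
    refine ⟨?_, ?_, ?_⟩ <;> refine mul_left_cancel₀ hne ?_
    all_goals
      rw [hdist, ← ha, ← hb, ← hc, deletedHesse]
      ring
  obtain ⟨e0, e1, e2⟩ := hcomb
  -- Applying aE + bθ₁ + cθ₂ = (x - y)v to `f` gives this sum times `f`, and v annihilates `f`.
  have hsum : 8 * a + b * firstQuotient + c * secondQuotient = 0 := by
    refine mul_left_cancel₀ hne ?_
    have h3 : (X 0 - X 1) * (v 0 * pderiv 0 deletedHesse + v 1 * pderiv 1 deletedHesse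
      + v 2 * pderiv 2 deletedHesse) = 0 := by rw [hv', mul_zero]
    rw [show (X 0 - X 1) * (v 0 * pderiv 0 deletedHesse + v 1 * pderiv 1 deletedHesse
      + v 2 * pderiv 2 deletedHesse) = ((X 0 - X 1) * v 0) * pderiv 0 deletedHesse +
        ((X 0 - X 1) * v 1) * pderiv 1 deletedHesse + ((X 0 - X 1) * v 2) * pderiv 2 deletedHesse
      by ring, e0, e1, e2] at h3
    rw [mul_zero, ← h3]
    simp only [pderiv_deletedHesse, Matrix.cons_val]
    simp only [deletedHesse, firstQuotient, secondQuotient]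
    ring
  refine ⟨b, c, fun i => ?_⟩
  fin_cases i <;> simp [syzygyMatrix]
  · linear_combination 8 * e0 + X 0 * hsum
  · linear_combination 8 * e1 + X 1 * hsum
  · linear_combination 8 * e2 + X 2 * hsum

theorem syzygyMatrix_relation (i : Fin 3) :
    X 0 * syzygyMatrix i 0 + X 2 * syzygyMatrix i 1 + (X 0 - X 1) * syzygyMatrix i 2 = 0 := by
  fin_cases i <;>
    simp [syzygyMatrix, firstQuotient, secondQuotient, thirdQuotient] <;> ring

theorem gradientMap_syzygyMatrix (w : Fin 3 → S) :
    gradientMap deletedHesse (syzygyMatrix.mulVec w) = 0 := by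
  simp only [gradientMap, Fintype.linearCombination_apply, Fin.sum_univ_three, Matrix.mulVec,
    dotProduct, pderiv_deletedHesse, smul_eq_mul]
  simp [syzygyMatrix, firstQuotient, secondQuotient, thirdQuotient]
  ring

theorem exact_syzygyMatrix_gradientMap (hs : Squarefree deletedHesse) :
    Function.Exact syzygyMatrix.mulVecLin (gradientMap deletedHesse) := by
  intro v
  refine ⟨fun hv => ?_, ?_⟩
  swap
  · rintro ⟨w, rfl⟩
    exact gradientMap_syzygyMatrix w
  obtain ⟨b, c, h⟩ := exists_combination_of_gradientMap_eq_zero hs hv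
  have hdvd : (X 0 - X 1 : S) ∣ b * X 2 - c * X 0 := by
    have hne : ¬ (X 0 - X 1 : S) ∣ 8 * X 0 * (X 2 ^ 3 - X 0 ^ 3) :=
      not_X_sub_X_dvd (by simp)
    refine (X_sub_X_prime.dvd_or_dvd ?_).resolve_left hne
    -- Multiplying row 0 by z and row 2 by x and subtracting kills the E terms; the term with `c`
    -- replaces y² by x².
    refine ⟨8 * X 0 * v 2 - 8 * X 2 * v 0 - 8 * c * (X 0 + X 1) * (X 2 ^ 3 - X 0 ^ 3), ?_⟩
    have h0 := h 0
    have h2 := h 2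
    simp [syzygyMatrix] at h0 h2
    linear_combination X 2 * h0 - X 0 * h2
  obtain ⟨s₁, s₂, t, rfl, rfl⟩ := eq_of_X_sub_X_dvd_sub hdvd
  refine ⟨![C (1 / 8) * s₁, C (1 / 8) * s₂, - (C (1 / 8) * t)], ?_⟩
  funext i
  have h8 : (C (1 / 8) : S) * 8 = 1 := by
    rw [show (8 : S) = C 8 from (map_ofNat C 8).symm, ← C_mul]; norm_num
  refine mul_left_cancel₀ X_sub_X_prime.ne_zero ?_
  simp only [Matrix.mulVecLin_apply, Matrix.mulVec, dotProduct, Fin.sum_univ_three,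
    Matrix.cons_val]
  linear_combination - C (1 / 8) * h i + (X 0 - X 1) * v i * h8 -
    C (1 / 8) * t * syzygyMatrix_relation i

theorem exact_relationMatrix_syzygyMatrix :
    Function.Exact relationMatrix.mulVecLin syzygyMatrix.mulVecLin := by
  intro w
  constructor
  · intro h
    have hrow (i : Fin 3) : w 0 * syzygyMatrix i 0 + w 1 * syzygyMatrix i 1
        + w 2 * syzygyMatrix i 2 = 0 := by
      have := congrFun h i
      simp [Matrix.mulVec, dotProduct, Fin.sum_univ_three] at this
      linear_combination this
    set p := (X 0 - X 1) * w 0 - X 0 * w 2 with hp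
    set q := (X 0 - X 1) * w 1 - X 2 * w 2 with hq
    have hpq (i : Fin 3) : p * syzygyMatrix i 0 + q * syzygyMatrix i 1 = 0 := by
      linear_combination (X 0 - X 1) * hrow i - w 2 * syzygyMatrix_relation i
    -- σ₁ and σ₂ are independent: this minor is -24 at (1, 0, 1). Eliminating σ₃ therefore
    -- determines the relation up to a factor.
    have hminor : syzygyMatrix 0 0 * syzygyMatrix 1 1 - syzygyMatrix 0 1 * syzygyMatrix 1 0 ≠ 0 := by
      intro h
      have := congrArg (eval ![1, 0, 1]) h
      simp [syzygyMatrix, firstQuotient, secondQuotient] at this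
      norm_num at this
    have hp0 : p = 0 := by
      refine (mul_eq_zero.1 ?_).resolve_right hminor
      linear_combination syzygyMatrix 1 1 * hpq 0 - syzygyMatrix 0 1 * hpq 1
    have hq0 : q = 0 := by
      refine (mul_eq_zero.1 ?_).resolve_right hminor
      linear_combination syzygyMatrix 0 0 * hpq 1 - syzygyMatrix 1 0 * hpq 0
    obtain ⟨u, hu⟩ : (X 0 - X 1 : S) ∣ w 2 := by
      refine (X_sub_X_prime.dvd_or_dvd (?_ : _ ∣ X 0 * w 2)).resolve_left
        (not_X_sub_X_dvd (by simp))
      exact ⟨w 0, by linear_combination hp - hp0⟩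
    refine ⟨fun _ => u, ?_⟩
    funext i
    refine mul_left_cancel₀ X_sub_X_prime.ne_zero ?_
    fin_cases i <;> simp only [relationMatrix, Matrix.mulVecLin_apply, Matrix.mulVec, dotProduct,
      Fin.sum_univ_one, Matrix.of_apply, Matrix.cons_val, Fin.zero_eta, Fin.mk_one,
      Fin.reduceFinMk]
    · linear_combination hp - hp0 - X 0 * hu
    · linear_combination hq - hq0 - X 2 * hu
    · linear_combination -(X 0 - X 1) * hu
  · rintro ⟨u, rfl⟩
    funext i
    simp [Matrix.mulVec, dotProduct, Fin.sum_univ_three, relationMatrix]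
    linear_combination u 0 * syzygyMatrix_relation i

theorem relationMatrix_injective : Function.Injective relationMatrix.mulVecLin := by
  rw [injective_iff_map_eq_zero]
  intro u hu
  have := congrFun hu 0
  simp [Matrix.mulVec, dotProduct, relationMatrix, X_ne_zero] at this
  funext i
  fin_cases i
  simpa using this

/-! ### Linear changes of coordinates -/

/-- The substitution of `S` induced by a linear map `e` of `ℂ³`: precomposition with `e`. -/
def linearSubst (e : (Fin 3 → ℂ) →ₗ[ℂ] (Fin 3 → ℂ)) : S →ₐ[ℂ] S :=
  aeval fun j => formPolynomial (LinearMap.proj j ∘ₗ e)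

theorem formPolynomial_proj (i : Fin 3) : formPolynomial (LinearMap.proj i) = X i := by
  simp [formPolynomial, Pi.single_apply]

theorem linearSubst_X (e : (Fin 3 → ℂ) →ₗ[ℂ] (Fin 3 → ℂ)) (j : Fin 3) :
    linearSubst e (X j) = formPolynomial (LinearMap.proj j ∘ₗ e) := by
  simp [linearSubst]

theorem linearSubst_C (e : (Fin 3 → ℂ) →ₗ[ℂ] (Fin 3 → ℂ)) (c : ℂ) :
    linearSubst e (C c) = C c := by
  simp [linearSubst]

theorem linearSubst_formPolynomial (e : (Fin 3 → ℂ) →ₗ[ℂ] (Fin 3 → ℂ))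
    (φ : Module.Dual ℂ (Fin 3 → ℂ)) :
    linearSubst e (formPolynomial φ) = formPolynomial (φ ∘ₗ e) := by
  have h (v : Fin 3 → ℂ) : φ v = ∑ j, φ (Pi.single j 1) * v j := by
    rw [LinearMap.pi_apply_eq_sum_univ φ v]
    refine Finset.sum_congr rfl fun j _ => ?_
    rw [smul_eq_mul, mul_comm]
    congr 3
    ext k
    simp [Pi.single_apply, eq_comm]
  conv_lhs => simp only [formPolynomial, map_sum, map_mul, linearSubst_C, linearSubst_X]
  simp only [formPolynomial, Finset.mul_sum]
  rw [Finset.sum_comm]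
  refine Finset.sum_congr rfl fun i _ => ?_
  rw [LinearMap.comp_apply, h, map_sum, Finset.sum_mul]
  refine Finset.sum_congr rfl fun j _ => ?_
  simp [mul_assoc]

theorem linearSubst_linearSubst (e e' : (Fin 3 → ℂ) →ₗ[ℂ] (Fin 3 → ℂ)) (p : S) :
    linearSubst e (linearSubst e' p) = linearSubst (e' ∘ₗ e) p := by
  suffices h : (linearSubst e).comp (linearSubst e') = linearSubst (e' ∘ₗ e) from
    DFunLike.congr_fun h p
  refine algHom_ext fun i => ?_
  simp only [AlgHom.comp_apply, linearSubst_X, linearSubst_formPolynomial, LinearMap.comp_assoc]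

theorem linearSubst_id (p : S) : linearSubst LinearMap.id p = p := by
  suffices h : linearSubst LinearMap.id = AlgHom.id ℂ S from DFunLike.congr_fun h p
  refine algHom_ext fun i => ?_
  simp only [linearSubst_X, LinearMap.comp_id, formPolynomial_proj, AlgHom.id_apply]

theorem linearSubst_symm_apply (e : (Fin 3 → ℂ) ≃ₗ[ℂ] (Fin 3 → ℂ)) (p : S) :
    linearSubst e.symm (linearSubst e p) = p := by
  simp [linearSubst_linearSubst, linearSubst_id]

theorem linearSubst_apply_symm (e : (Fin 3 → ℂ) ≃ₗ[ℂ] (Fin 3 → ℂ)) (p : S) :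
    linearSubst e (linearSubst e.symm p) = p := by
  simp [linearSubst_linearSubst, linearSubst_id]

theorem linearSubst_injective (e : (Fin 3 → ℂ) ≃ₗ[ℂ] (Fin 3 → ℂ)) :
    Function.Injective (linearSubst (e : (Fin 3 → ℂ) →ₗ[ℂ] (Fin 3 → ℂ))) :=
  Function.LeftInverse.injective (linearSubst_symm_apply e)

theorem formPolynomial_isHomogeneous (φ : Module.Dual ℂ (Fin 3 → ℂ)) :
    (formPolynomial φ).IsHomogeneous 1 :=
  IsHomogeneous.sum _ _ _ fun i _ => isHomogeneous_C_mul_X _ i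

theorem IsHomogeneous.linearSubst {p : S} {n : ℕ} (hp : p.IsHomogeneous n)
    (e : (Fin 3 → ℂ) →ₗ[ℂ] (Fin 3 → ℂ)) : (linearSubst e p).IsHomogeneous n := by
  simpa [PlaneCurve.linearSubst] using hp.aeval _ fun i => formPolynomial_isHomogeneous _

theorem constantCoeff_linearSubst (e : (Fin 3 → ℂ) →ₗ[ℂ] (Fin 3 → ℂ)) (p : S) :
    constantCoeff (linearSubst e p) = constantCoeff p := by
  suffices h : ((constantCoeff (σ := Fin 3) (R := ℂ))).comp (linearSubst e).toRingHom =
    constantCoeff from DFunLike.congr_fun h p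
  refine ringHom_ext (fun c => ?_) fun i => ?_
  · simp
  · simp [linearSubst_X, formPolynomial]

theorem pderiv_formPolynomial (i : Fin 3) (φ : Module.Dual ℂ (Fin 3 → ℂ)) :
    pderiv i (formPolynomial φ) = C (φ (Pi.single i 1)) := by
  simp [formPolynomial, pderiv_X, Pi.single_apply]

/-- The chain rule. -/
theorem pderiv_linearSubst (e : (Fin 3 → ℂ) →ₗ[ℂ] (Fin 3 → ℂ)) (i : Fin 3) (p : S) :
    pderiv i (linearSubst e p) =
      ∑ j, linearSubst e (pderiv j p) * C (LinearMap.toMatrix' e j i) := by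
  induction p using MvPolynomial.induction_on with
  | C a => simp
  | add p q hp hq => simp only [map_add, hp, hq, add_mul, Finset.sum_add_distrib]
  | mul_X p k hp =>
    have hk : ∑ j, linearSubst e (pderiv j (X k)) * C (LinearMap.toMatrix' e j i) =
        pderiv i (linearSubst e (X k)) := by
      rw [Finset.sum_eq_single k, linearSubst_X, pderiv_formPolynomial, pderiv_X_self, map_one,
        one_mul, LinearMap.toMatrix'_apply]
      · rfl
      · intro j _ hj
        rw [pderiv_X_of_ne hj.symm, map_zero, zero_mul]
      · exact fun h => absurd (Finset.mem_univ k) h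
    rw [map_mul, pderiv_mul, hp, ← hk, Finset.sum_mul, Finset.mul_sum, ← Finset.sum_add_distrib]
    refine Finset.sum_congr rfl fun j _ => ?_
    rw [pderiv_mul, map_add, map_mul, map_mul]
    ring

/-- The matrix of the substitution, with polynomial entries. -/
def substMatrix (e : (Fin 3 → ℂ) →ₗ[ℂ] (Fin 3 → ℂ)) : Matrix (Fin 3) (Fin 3) S :=
  (LinearMap.toMatrix' e).map C

theorem substMatrix_mul_symm (e : (Fin 3 → ℂ) ≃ₗ[ℂ] (Fin 3 → ℂ)) :
    substMatrix e * substMatrix e.symm = 1 := by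
  rw [substMatrix, substMatrix, ← Matrix.map_mul, ← LinearMap.toMatrix'_comp]
  simp [Matrix.map_one C C_0 C_1]

theorem substMatrix_symm_mul (e : (Fin 3 → ℂ) ≃ₗ[ℂ] (Fin 3 → ℂ)) :
    substMatrix e.symm * substMatrix e = 1 :=
  mul_eq_one_comm.1 (substMatrix_mul_symm e)

theorem gradientMap_linearSubst (e : (Fin 3 → ℂ) →ₗ[ℂ] (Fin 3 → ℂ)) (c : ℂ) (p : S)
    (v : Fin 3 → S) :
    gradientMap (C c * linearSubst e p) v =
      C c * ∑ j, (substMatrix e).mulVec v j * linearSubst e (pderiv j p) := by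
  simp only [gradientMap, Fintype.linearCombination_apply, pderiv_C_mul, pderiv_linearSubst,
    substMatrix, Matrix.mulVec, dotProduct, smul_eq_mul, Matrix.map_apply]
  simp only [Fin.sum_univ_three]
  ring

theorem map_linearSubst_mulVec (e : (Fin 3 → ℂ) ≃ₗ[ℂ] (Fin 3 → ℂ)) {m n : ℕ}
    (A : Matrix (Fin m) (Fin n) S) (v : Fin n → S) :
    (A.map (linearSubst e)).mulVec v =
      linearSubst e ∘ A.mulVec (linearSubst e.symm ∘ v) := by
  funext i
  simp [Matrix.mulVec, dotProduct, linearSubst_apply_symm]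

theorem linearSubst_comp_zero (e : (Fin 3 → ℂ) →ₗ[ℂ] (Fin 3 → ℂ)) {n : ℕ} :
    linearSubst e ∘ (0 : Fin n → S) = 0 := by
  funext i
  simp

theorem linearSubst_comp_eq_iff (e : (Fin 3 → ℂ) ≃ₗ[ℂ] (Fin 3 → ℂ)) {n : ℕ} (v w : Fin n → S) :
    linearSubst e ∘ v = w ↔ v = linearSubst e.symm ∘ w := by
  constructor <;> rintro rfl <;> funext i <;>
    simp [linearSubst_symm_apply, linearSubst_apply_symm]

theorem IsMinimalGraded.map_linearSubst {m n : ℕ} {a : Fin m → ℕ} {b : Fin n → ℕ}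
    {A : Matrix (Fin m) (Fin n) S} (h : IsMinimalGraded a b A)
    (e : (Fin 3 → ℂ) →ₗ[ℂ] (Fin 3 → ℂ)) : IsMinimalGraded a b (A.map (linearSubst e)) := by
  intro i j
  obtain ⟨h1, h2⟩ := h i j
  refine ⟨h1.imp (fun h => by simp [h]) fun h => ⟨h.1, IsHomogeneous.linearSubst h.2 e⟩, ?_⟩
  rw [Matrix.map_apply, constantCoeff_linearSubst, h2]

theorem IsMinimalGraded.substMatrix_mul {n : ℕ} {a : ℕ} {b : Fin n → ℕ}
    {A : Matrix (Fin 3) (Fin n) S} (h : IsMinimalGraded (fun _ => a) b A)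
    (e : (Fin 3 → ℂ) →ₗ[ℂ] (Fin 3 → ℂ)) :
    IsMinimalGraded (fun _ => a) b (substMatrix e * A) := by
  intro i j
  constructor
  · by_cases hab : a ≤ b j
    · refine Or.inr ⟨hab, ?_⟩
      rw [Matrix.mul_apply]
      refine IsHomogeneous.sum _ _ _ fun k _ => ?_
      refine IsHomogeneous.C_mul ?_ _
      rcases (h k j).1 with h | h
      · rw [h]; exact isHomogeneous_zero _ _ _
      · exact h.2
    · left
      rw [Matrix.mul_apply]
      exact Finset.sum_eq_zero fun k _ => by
        rw [((h k j).1).resolve_right fun h => hab h.1, mul_zero]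
  · rw [Matrix.mul_apply, map_sum]
    exact Finset.sum_eq_zero fun k _ => by rw [map_mul, (h k j).2, mul_zero]

/-- The property of being an `m`-syzygy curve with given exponents is invariant under projective
transformations. -/
theorem IsSyzygyCurve.linearSubst {f : S} {d m : ℕ} {δ : Fin m → ℕ} (h : IsSyzygyCurve f d m δ)
    (e : (Fin 3 → ℂ) ≃ₗ[ℂ] (Fin 3 → ℂ)) {c : ℂ} (hc : c ≠ 0) :
    IsSyzygyCurve (C c * PlaneCurve.linearSubst e f) d m δ := by
  obtain ⟨⟨hd, hhom, hsq⟩, hm, hδ, hδ1, ε, A, B, hε, hA, hB, hinj, hBA, hAg, -, -⟩ := h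
  have hcu : IsUnit (C c : S) := (isUnit_iff_ne_zero.2 hc).map C
  -- By the chain rule the gradient map acquires `substMatrix e`, which the inverse matrix in front
  -- of the transformed syzygies compensates.
  refine ⟨⟨hd, ?_, ?_⟩, hm, hδ, hδ1, ε, substMatrix e.symm * A.map (PlaneCurve.linearSubst e),
    B.map (PlaneCurve.linearSubst e), hε, (hA.map_linearSubst _).substMatrix_mul _,
    hB.map_linearSubst _, ?_, ?_, ?_, ?_, Submodule.mkQ_surjective _⟩
  · exact (IsHomogeneous.linearSubst hhom _).C_mul c
  · intro q hq
    have h1 := map_dvd (PlaneCurve.linearSubst e.symm) ((hcu.dvd_mul_left).1 hq)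
    rw [linearSubst_symm_apply, map_mul] at h1
    have h2 := (hsq _ h1).map (PlaneCurve.linearSubst (e : (Fin 3 → ℂ) →ₗ[ℂ] (Fin 3 → ℂ)))
    rwa [linearSubst_apply_symm] at h2
  · rw [injective_iff_map_eq_zero] at hinj ⊢
    intro u hu
    rw [Matrix.mulVecLin_apply, map_linearSubst_mulVec, linearSubst_comp_eq_iff] at hu
    have h1 := hinj _ (hu.trans (linearSubst_comp_zero _))
    rw [← (linearSubst_comp_eq_iff e 0 u).2 h1.symm, linearSubst_comp_zero]
  · intro v
    have h1 : (substMatrix e.symm * A.map (PlaneCurve.linearSubst e)).mulVecLin v = 0 ↔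
        A.mulVecLin (PlaneCurve.linearSubst e.symm ∘ v) = 0 := by
      rw [Matrix.mulVecLin_apply, ← Matrix.mulVec_mulVec, map_linearSubst_mulVec,
        Matrix.mulVecLin_apply]
      constructor
      · intro h
        have h2 := congrArg (substMatrix e).mulVec h
        rw [Matrix.mulVec_mulVec, substMatrix_mul_symm, Matrix.one_mulVec, Matrix.mulVec_zero,
          linearSubst_comp_eq_iff] at h2
        rw [h2, linearSubst_comp_zero]
      · intro h
        rw [h, linearSubst_comp_zero, Matrix.mulVec_zero]
    rw [h1, hBA]
    constructor
    · rintro ⟨u, hu⟩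
      refine ⟨PlaneCurve.linearSubst e ∘ u, ?_⟩
      rw [Matrix.mulVecLin_apply] at hu ⊢
      rw [map_linearSubst_mulVec, linearSubst_comp_eq_iff, ← hu,
        ← (linearSubst_comp_eq_iff e u _).1 rfl]
    · rintro ⟨u, rfl⟩
      refine ⟨PlaneCurve.linearSubst e.symm ∘ u, ?_⟩
      rw [Matrix.mulVecLin_apply, Matrix.mulVecLin_apply, map_linearSubst_mulVec,
        ← linearSubst_comp_eq_iff]
  · intro v
    have h1 : gradientMap (C c * PlaneCurve.linearSubst e f) v = 0 ↔
        gradientMap f (PlaneCurve.linearSubst e.symm ∘ (substMatrix e).mulVec v) = 0 := by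
      rw [gradientMap_linearSubst, mul_eq_zero, or_iff_right hcu.ne_zero]
      conv_rhs => rw [← (linearSubst_injective e).eq_iff, map_zero]
      simp [gradientMap, Fintype.linearCombination_apply, linearSubst_apply_symm]
    rw [h1, hAg]
    constructor
    · rintro ⟨w, hw⟩
      refine ⟨PlaneCurve.linearSubst e ∘ w, ?_⟩
      rw [Matrix.mulVecLin_apply] at hw ⊢
      rw [← Matrix.mulVec_mulVec, map_linearSubst_mulVec,
        ← (linearSubst_comp_eq_iff e w _).1 rfl, (linearSubst_comp_eq_iff e _ _).2 hw,
        Matrix.mulVec_mulVec, substMatrix_symm_mul, Matrix.one_mulVec]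
    · rintro ⟨w, rfl⟩
      refine ⟨PlaneCurve.linearSubst e.symm ∘ w, ?_⟩
      rw [Matrix.mulVecLin_apply, Matrix.mulVecLin_apply, Matrix.mulVec_mulVec,
        ← Matrix.mul_assoc, substMatrix_mul_symm, Matrix.one_mul, map_linearSubst_mulVec,
        ← linearSubst_comp_eq_iff]
  · intro x
    rw [← LinearMap.mem_ker, Submodule.ker_mkQ, jacobianIdeal, Ideal.span,
      ← Fintype.range_linearCombination]
    rfl

/-! ### Equations of line arrangements are squarefree -/

theorem formPolynomial_smul (a : ℂ) (φ : Module.Dual ℂ (Fin 3 → ℂ)) :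
    formPolynomial (a • φ) = C a * formPolynomial φ := by
  simp [formPolynomial, Finset.mul_sum, mul_assoc]

theorem formPolynomial_injective : Function.Injective formPolynomial := by
  intro φ ψ h
  refine LinearMap.pi_ext' fun i => LinearMap.ext_ring ?_
  have h1 := congrArg (pderiv i) h
  rw [pderiv_formPolynomial, pderiv_formPolynomial] at h1
  simpa using C_injective _ _ h1

theorem eq_of_formPolynomial_rep_dvd {ℓ ℓ' : Line}
    (h : formPolynomial ℓ.rep ∣ formPolynomial ℓ'.rep) : ℓ = ℓ' := by
  obtain ⟨u, hu⟩ := ((prime_formPolynomial ℓ.rep_nonzero).irreducible.associated_of_dvd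
    (prime_formPolynomial ℓ'.rep_nonzero).irreducible h)
  obtain ⟨a, -, ha⟩ := isUnit_iff_eq_C_of_isReduced.1 u.isUnit
  rw [ha, mul_comm, ← formPolynomial_smul] at hu
  rw [← ℓ.mk_rep, ← ℓ'.mk_rep]
  exact ((Projectivization.mk_eq_mk_iff' ℂ _ _ ℓ'.rep_nonzero ℓ.rep_nonzero).2
    ⟨a, formPolynomial_injective hu⟩).symm

theorem squarefree_prod_formPolynomial (L : Finset Line) :
    Squarefree (∏ ℓ ∈ L, formPolynomial ℓ.rep) := by
  classical
  induction L using Finset.induction_on with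
  | empty => simp
  | insert ℓ L hℓ ih =>
    rw [Finset.prod_insert hℓ, squarefree_mul_iff]
    refine ⟨IsRelPrime.prod_right fun ℓ' h' => ?_,
      (prime_formPolynomial ℓ.rep_nonzero).irreducible.squarefree, ih⟩
    rw [(prime_formPolynomial ℓ.rep_nonzero).irreducible.isRelPrime_iff_not_dvd]
    exact fun h => hℓ (eq_of_formPolynomial_rep_dvd h ▸ h')

theorem IsEquation.squarefree {L : Finset Line} {f : S} (hf : IsEquation L f) : Squarefree f := by
  obtain ⟨c, hc, rfl⟩ := hf
  have hcu : IsUnit (C c : S) := (isUnit_iff_ne_zero.2 hc).map C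
  exact fun q hq => squarefree_prod_formPolynomial L q ((hcu.dvd_mul_left).1 hq)

/-- Lets `deletedHesse` inherit squarefreeness from the given equation, a product of pairwise
non-associated linear forms. -/
theorem squarefree_of_linearSubst {e : (Fin 3 → ℂ) →ₗ[ℂ] (Fin 3 → ℂ)} {c : ℂ} {f : S}
    (h : Squarefree (C c * linearSubst e f)) (he : ∀ p, IsUnit (linearSubst e p) → IsUnit p) :
    Squarefree f := fun q hq => he q <| h _ <| by
  rw [← map_mul]
  exact (map_dvd _ hq).mul_left _

/-! ### The minimal resolution of the model -/

theorem isSyzygyCurve_deletedHesse (hs : Squarefree deletedHesse) :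
    IsSyzygyCurve deletedHesse 8 3 ![4, 4, 4] := by
  have hX (i : Fin 3) (n : ℕ) : (X i ^ n : S).IsHomogeneous n := isHomogeneous_X_pow i n
  have hC (k : ℕ) [k.AtLeastTwo] {p : S} {n : ℕ} (hp : p.IsHomogeneous n) :
      ((OfNat.ofNat k : S) * p).IsHomogeneous n := by
    rw [← map_ofNat (C : ℂ →+* S) k]
    exact hp.C_mul _
  have hmul {p q : S} {m n k : ℕ} (hp : p.IsHomogeneous m) (hq : q.IsHomogeneous n)
      (hk : m + n = k) : (p * q).IsHomogeneous k := hk ▸ hp.mul hq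
  have hX1 (i : Fin 3) : (X i : S).IsHomogeneous 1 := isHomogeneous_X ℂ i
  have h1 : firstQuotient.IsHomogeneous 3 :=
    ((((hC 5 (hX 0 3)).add (hC 5 (hX 1 3))).add (hC 6 (hX 2 3))).sub
      (hmul (hX 0 2) (hX1 1) rfl)).sub (hmul (hX1 0) (hX 1 2) rfl)
  have hlin : (X 0 + X 1 : S).IsHomogeneous 1 := (hX1 0).add (hX1 1)
  have h2 : secondQuotient.IsHomogeneous 3 := hmul (hX 2 2) hlin rfl
  have h3 : thirdQuotient.IsHomogeneous 3 := by
    refine (((hC 3 (hX 0 3)).add ?_).add ?_).add (hX 2 3)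
    · rw [mul_assoc]; exact hC 4 (hmul (hX 0 2) (hX1 1) rfl)
    · rw [mul_assoc]; exact hC 5 (hmul (hX1 0) (hX 1 2) rfl)
  have hA : ∀ i j, (syzygyMatrix i j).IsHomogeneous 4 := by
    have hq {p q : S} (i : Fin 3) (hp : p.IsHomogeneous 4) (hq : q.IsHomogeneous 3) :
        (8 * p - q * X i).IsHomogeneous 4 := (hC 8 hp).sub (hmul hq (hX1 i) rfl)
    intro i j
    fin_cases i <;> fin_cases j
    · exact hq 0 (hX 0 4) h1
    · exact hq 0 (hmul (hX 1 2) (hX 2 2) rfl) h2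
    · exact hq 0 (hmul (hX 2 3) hlin rfl) h3
    · exact hq 1 (hX 1 4) h1
    · exact hq 1 (hmul (hX 0 2) (hX 2 2) rfl) h2
    · refine hq 1 ((hmul (n := 2) (hmul (hX1 0) (hX1 1) rfl) ?_ rfl).sub
        (hmul (hX1 0) (hX 2 3) rfl)) h3
      exact ((hX 0 2).add (hmul (hX1 0) (hX1 1) rfl)).add (hX 1 2)
    · exact hq 2 (hX 2 4) h1
    · exact hq 2 (hmul (hX 0 2) (hX 1 2) rfl) h2
    · exact hq 2 (hmul (hmul (hX 0 2) (hX1 2) rfl) hlin rfl) h3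
  have hB : ∀ i j, (relationMatrix i j).IsHomogeneous 1 := by
    intro i j
    fin_cases j
    fin_cases i
    · exact hX1 0
    · exact hX1 2
    · exact (hX1 0).sub (hX1 1)
  have hconst {p : S} {n : ℕ} (hp : p.IsHomogeneous n) (hn : n ≠ 0) : constantCoeff p = 0 :=
    hp.coeff_eq_zero (by simpa using hn.symm)
  have hδ : (![4, 4, 4] : Fin 3 → ℕ) = fun _ => 4 := by
    funext j; fin_cases j <;> rfl
  rw [hδ]
  -- The last twist is 12 = (8 - 1) + 4 + 1: a linear relation between syzygies of degree 4.
  exact ⟨⟨by norm_num, deletedHesse_isHomogeneous, hs⟩, by norm_num, monotone_const,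
    fun _ => by norm_num, fun _ => 12, syzygyMatrix, relationMatrix, monotone_const,
    fun i j => ⟨Or.inr ⟨by norm_num, hA i j⟩, hconst (hA i j) (by norm_num)⟩,
    fun i j => ⟨Or.inr ⟨by norm_num, hB i j⟩, hconst (hB i j) (by norm_num)⟩,
    relationMatrix_injective, exact_relationMatrix_syzygyMatrix,
    exact_syzygyMatrix_gradientMap hs, fun x => by
      rw [← LinearMap.mem_ker, Submodule.ker_mkQ, jacobianIdeal, Ideal.span,
        ← Fintype.range_linearCombination]
      rfl, Submodule.mkQ_surjective _⟩

/-! ### Symmetry of the dual Hesse arrangement -/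

theorem exists_formPolynomial_mk_rep (φ : Module.Dual ℂ (Fin 3 → ℂ)) (hφ : φ ≠ 0) :
    ∃ a : ℂ, a ≠ 0 ∧
      formPolynomial (Projectivization.mk ℂ φ hφ).rep = C a * formPolynomial φ := by
  obtain ⟨a, ha⟩ := Projectivization.exists_smul_eq_mk_rep ℂ φ hφ
  exact ⟨a, a.ne_zero, by rw [← ha, ← formPolynomial_smul]; rfl⟩

theorem formPolynomial_hesseForm (i : Fin 3) (ζ : ℂ) :
    formPolynomial (hesseForm i ζ) = X i - C ζ * X (i + 1) := by
  rw [← formPolynomial_proj i, ← formPolynomial_proj (i + 1)]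
  simp only [formPolynomial, hesseForm, LinearMap.sub_apply, LinearMap.smul_apply, smul_eq_mul,
    map_sub, map_mul, sub_mul, Finset.sum_sub_distrib, Finset.mul_sum, mul_assoc]

theorem hesseForm_inj {i j : Fin 3} {ζ ξ a : ℂ} (hξ : ξ ≠ 0)
    (h : a • hesseForm i ζ = hesseForm j ξ) : i = j ∧ ζ = ξ := by
  have h0 := LinearMap.congr_fun h (Pi.single 0 1)
  have h1 := LinearMap.congr_fun h (Pi.single 1 1)
  have h2 := LinearMap.congr_fun h (Pi.single 2 1)
  fin_cases i <;> fin_cases j <;> simp [hesseForm] at h0 h1 h2 <;> simp_all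

/-- The equation of the dual Hesse arrangement. -/
def dualHesse : S := (X 0 ^ 3 - X 1 ^ 3) * (X 1 ^ 3 - X 2 ^ 3) * (X 2 ^ 3 - X 0 ^ 3)

theorem dualHesse_eq : dualHesse = (X 0 - X 1) * deletedHesse := by
  rw [dualHesse, deletedHesse]; ring

theorem prod_formPolynomial_hesseForm {ω : ℂ} (hω : IsPrimitiveRoot ω 3) :
    ∏ p : Fin 3 × Fin 3, formPolynomial (hesseForm p.1 (ω ^ (p.2 : ℕ))) = dualHesse := by
  have hsum : (1 + C ω + C ω ^ 2 : S) = 0 := by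
    have h := hω.geom_sum_eq_zero (by norm_num)
    simp only [Finset.sum_range_succ, Finset.sum_range_zero] at h
    simpa using congrArg (C : ℂ → S) h
  have key (x y : S) : (x - y) * (x - C ω * y) * (x - C ω ^ 2 * y) = x ^ 3 - y ^ 3 := by
    linear_combination (-x ^ 2 * y + C ω * x * y ^ 2 + (1 - C ω) * y ^ 3) * hsum
  rw [Fintype.prod_prod_type]
  simp only [formPolynomial_hesseForm, Fin.prod_univ_three, dualHesse]
  simp [key]

/-- The linear automorphism of `ℂ³` that takes the line `x_i = ζ x_{i+1}` to `x = y`. -/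
def hesseRotation (i : Fin 3) (ζ : ℂ) : (Fin 3 → ℂ) →ₗ[ℂ] (Fin 3 → ℂ) :=
  LinearMap.pi ![LinearMap.proj i, ζ • LinearMap.proj (i + 1), LinearMap.proj (i + 2)]

theorem hesseRotation_injective (i : Fin 3) {ζ : ℂ} (hζ : ζ ≠ 0) :
    Function.Injective (hesseRotation i ζ) := by
  intro v w h
  have h0 := congrFun h 0
  have h1 := congrFun h 1
  have h2 := congrFun h 2
  simp [hesseRotation, hζ] at h0 h1 h2
  funext k
  fin_cases i <;> fin_cases k <;> simp at h0 h1 h2 ⊢ <;> assumption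

theorem linearSubst_hesseRotation_X (i : Fin 3) (ζ : ℂ) (j : Fin 3) :
    linearSubst (hesseRotation i ζ) (X j) =
      (![X i, C ζ * X (i + 1), X (i + 2)] : Fin 3 → S) j := by
  rw [linearSubst_X, hesseRotation, LinearMap.proj_pi]
  fin_cases j
  · exact formPolynomial_proj _
  · exact (formPolynomial_smul _ _).trans (by rw [formPolynomial_proj]; rfl)
  · exact formPolynomial_proj _

/-- Only cubes of the variables occur, so ζ disappears and the cyclic shift permutes the three
factors. -/
theorem linearSubst_hesseRotation_dualHesse (i : Fin 3) {ζ : ℂ} (hζ : ζ ^ 3 = 1) :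
    linearSubst (hesseRotation i ζ) dualHesse = dualHesse := by
  have h : (C ζ ^ 3 : S) = 1 := by rw [← map_pow, hζ, map_one]
  simp only [dualHesse, map_mul, map_sub, map_pow, linearSubst_hesseRotation_X]
  simp only [Matrix.cons_val, mul_pow, h, one_mul]
  fin_cases i <;> simp <;> ring

/-- Every deletion of a line from the dual Hesse arrangement is projectively equivalent to the
deletion of `x = y` from the standard one. -/
theorem exists_linearSubst_deletedHesse [DecidableEq Line] {H : Finset Line} (hH : IsDualHesse H)
    {ℓ : Line} (hℓ : ℓ ∈ H) {f : S} (hf : IsEquation (H.erase ℓ) f) :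
    ∃ (e : (Fin 3 → ℂ) ≃ₗ[ℂ] (Fin 3 → ℂ)) (c : ℂ), c ≠ 0 ∧
      f = C c * linearSubst e deletedHesse := by
  obtain ⟨e, he⟩ := hH
  obtain ⟨c, hc, rfl⟩ := hf
  obtain ⟨ω, hω⟩ : ∃ ω : ℂ, IsPrimitiveRoot ω 3 :=
    ⟨_, Complex.isPrimitiveRoot_exp 3 (by norm_num)⟩
  have hω0 : ω ≠ 0 := hω.ne_zero (by norm_num)
  have hne (p : Fin 3 × Fin 3) : e.dualMap (hesseForm p.1 (ω ^ (p.2 : ℕ))) ≠ 0 := by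
    simpa using hesseForm_ne_zero _ _
  set g : Fin 3 × Fin 3 → Line := fun p => Projectivization.mk ℂ _ (hne p) with hg
  have hginj : Function.Injective g := by
    intro p q h
    obtain ⟨a, ha⟩ := (Projectivization.mk_eq_mk_iff' ℂ _ _ _ _).1 h
    rw [← map_smul] at ha
    obtain ⟨h1, h2⟩ := hesseForm_inj (pow_ne_zero _ hω0)
      (e.dualMap.injective ha)
    exact (Prod.ext h1 (Fin.ext (hω.pow_inj q.2.2 p.2.2 h2))).symm
  have hHg : H = Finset.univ.image g := by
    rw [← Finset.coe_inj, he]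
    ext m
    simp only [standardDualHesse, Set.mem_image, Set.mem_ofPred_eq, Finset.coe_image,
      Finset.coe_univ, Set.image_univ, Set.mem_range]
    constructor
    · rintro ⟨_, ⟨i, ζ, hζ, rfl⟩, rfl⟩
      obtain ⟨k, hk, rfl⟩ := hω.eq_pow_of_pow_eq_one hζ
      exact ⟨(i, ⟨k, hk⟩), rfl⟩
    · rintro ⟨p, rfl⟩
      exact ⟨_, ⟨p.1, ω ^ (p.2 : ℕ), by rw [← pow_mul, mul_comm, pow_mul, hω.pow_eq_one, one_pow],
        rfl⟩, rfl⟩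
  choose a ha ha' using fun p => exists_formPolynomial_mk_rep _ (hne p)
  have hsub (p : Fin 3 × Fin 3) : formPolynomial (g p).rep =
      C (a p) * linearSubst e (formPolynomial (hesseForm p.1 (ω ^ (p.2 : ℕ)))) := by
    rw [linearSubst_formPolynomial]
    exact ha' p
  have hprod : ∏ m ∈ H, formPolynomial m.rep = C (∏ p, a p) * linearSubst e dualHesse := by
    rw [hHg, Finset.prod_image fun p _ q _ h => hginj h, Finset.prod_congr rfl fun p _ => hsub p,
      Finset.prod_mul_distrib, ← map_prod, ← map_prod, prod_formPolynomial_hesseForm hω]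
  obtain ⟨p, rfl⟩ : ∃ p, g p = ℓ := by simpa [hHg] using hℓ
  set ζ := ω ^ (p.2 : ℕ) with hζ
  have hζ3 : ζ ^ 3 = 1 := by rw [hζ, ← pow_mul, mul_comm, pow_mul, hω.pow_eq_one, one_pow]
  set r := LinearEquiv.ofInjectiveEndo (hesseRotation p.1 ζ)
    (hesseRotation_injective p.1 (pow_ne_zero _ hω0)) with hr
  have hr' : (r : (Fin 3 → ℂ) →ₗ[ℂ] (Fin 3 → ℂ)) = hesseRotation p.1 ζ := by
    ext1; rfl
  have hline : formPolynomial (hesseForm p.1 ζ) = linearSubst r (X 0 - X 1) := by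
    rw [hr', map_sub, linearSubst_hesseRotation_X, linearSubst_hesseRotation_X,
      formPolynomial_hesseForm]
    rfl
  have hdual : dualHesse = linearSubst r (X 0 - X 1) * linearSubst r deletedHesse := by
    rw [← map_mul, ← dualHesse_eq, hr', linearSubst_hesseRotation_dualHesse _ hζ3]
  refine ⟨e.trans r, c * (∏ p, a p) / a p,
    div_ne_zero (mul_ne_zero hc (Finset.prod_ne_zero_iff.2 fun p _ => ha p)) (ha p), ?_⟩
  have h0 : formPolynomial (g p).rep ≠ 0 := (prime_formPolynomial (g p).rep_nonzero).ne_zero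
  -- Restoring the deleted line reduces the claim to the full product, which is known up to a
  -- constant.
  refine mul_left_cancel₀ h0 ?_
  rw [mul_left_comm, Finset.mul_prod_erase H (fun m => formPolynomial m.rep) hℓ, hprod, hsub p,
    ← hζ, hline, hdual, map_mul, LinearEquiv.coe_trans, ← linearSubst_linearSubst]
  have hcoeff : (C (a p) * C (c * (∏ p, a p) / a p) : S) = C c * C (∏ p, a p) := by
    rw [← C_mul, ← C_mul, mul_div_cancel₀ _ (ha p)]
  linear_combination -(linearSubst e (linearSubst r (X 0 - X 1))) *
    linearSubst e (linearSubst r deletedHesse) * hcoeff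

end PlaneCurve

end

theorem proposition5p4 [DecidableEq PlaneCurve.Line]
    (H : Finset PlaneCurve.Line) (hH : PlaneCurve.IsDualHesse H)
    (ℓ : PlaneCurve.Line) (hℓ : ℓ ∈ H)
    (f : PlaneCurve.S) (hf : PlaneCurve.IsEquation (H.erase ℓ) f) :
    PlaneCurve.IsPlusOneGenerated f 4 4 4 ∧ PlaneCurve.IsNearlyFree f := by
  have hsq := hf.squarefree
  obtain ⟨e, c, hc, rfl⟩ := PlaneCurve.exists_linearSubst_deletedHesse hH hℓ hf
  have hs : Squarefree PlaneCurve.deletedHesse :=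
    PlaneCurve.squarefree_of_linearSubst hsq fun p hp => by
      simpa only [PlaneCurve.linearSubst_symm_apply] using hp.map (PlaneCurve.linearSubst e.symm)
  have h : PlaneCurve.IsPlusOneGenerated
      (C c * PlaneCurve.linearSubst e PlaneCurve.deletedHesse) 4 4 4 :=
    ⟨8, (PlaneCurve.isSyzygyCurve_deletedHesse hs).linearSubst e hc, rfl⟩
  exact ⟨h, 4, 4, 4, h, rfl⟩
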